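/- Let $n\ge 1$, $s\in(\tfrac12,1)$ and $0<\lambda\le\Lambda$. Let $\mathcal K_s$ be the set of measurable kernels $K:\mathbb R^n\setminus\{0\}\to\mathbb R$ (not necessarily symmetric) with $\lambda|z|^{-n-2s}\le K(z)\le\Lambda|z|^{-n-2s}$ for $z\neq0$, and for $K\in\mathcal K_s$ put $$L_Ku(x)=\int_{\mathbb R^n}\bigl[u(x+z)-u(x)-1_{B}(z)\,\nabla u(x)\cdot z\bigr]K(z)\,dz,$$ where $B$ is the unit ball centred at $0$. Let $\omega_s(z)=(1+|z|)^{-n-2s}$, and write $u\in C^{1,1}(x)$ if there are $p\in\mathbb R^n$ and $C,r>0$ with $|u(x+z)-u(x)-p\cdot z|\le C|z|^2$ for $|z|<r$. Let $\mathcal I$ be an operator such that $\mathcal Iu(x)\in\mathbb R$ is defined whenever $u\in C^{1,1}(x)\cap L^1(\omega_s)$, which is translation invariant ($\mathcal I[u(\cdot+h)](x)=\mathcal Iu(x+h)$), positively $1$-homogeneous ($\mathcal I(tu)=t\,\mathcal Iu$ for $t>0$), and elliptic with respect to $\mathcal K_s$: $$\inf_{K\in\mathcal K_s}\bigl(L_Ku(x)-L_Kv(x)\bigr)\le\mathcal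 Iu(x)-\mathcal Iv(x)\le\sup_{K\in\mathcal K_s}\bigl(L_Ku(x)-L_Kv(x)\bigr)$$ for all $u,v\in C^{1,1}(x)\cap L^1(\omega_s)$. Let $m>2s$ and $q>0$. Then every bounded positive viscosity solution $u:\mathbb R^n\to(0,\infty)$ of $$-\mathcal Iu=u^q|\nabla u|^m\quad\text{in }\mathbb R^n$$ is constant. Here a measurable upper (lower) semicontinuous function $u:\mathbb R^n\to(0,\infty)$ in $L^1(\omega_s)$ is a viscosity subsolution (supersolution) if, whenever $x_0\in\mathbb R^n$, $r>0$ and $\varphi\in C^2(B_r(x_0))$ satisfy $u(x_0)=\varphi(x_0)$ and $u\le\varphi$ (resp. $u\ge\varphi$) in $B_r(x_0)$, and the function $v$ equal to $\varphi$ in $B_r(x_0)$ and to $u$ elsewhere belongs to $L^1(\omega_s)$, one has $$-\mathcal Iv(x_0)\le u(x_0)^q|\nabla\varphi(x_0)|^m\quad(\text{resp. }\ge).$$ A viscosity solution is a function that is both a subsolution and a supersolution. -/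

import Mathlib

open MeasureTheory

noncomputable section

namespace NonlocalLiouville

/-- Euclidean space `ℝⁿ`. -/
abbrev E (n : ℕ) : Type := EuclideanSpace ℝ (Fin n)

/-- The class `𝒦_s(λ, Λ)` of measurable kernels on `ℝⁿ \ {0}` with
`λ |z|^{-(n+2s)} ≤ K z ≤ Λ |z|^{-(n+2s)}`. A kernel is represented by a function on `ℝⁿ` whose
value at `0` is irrelevant; symmetry is not assumed. -/
def kernelClass (n : ℕ) (s lam Lam : ℝ) : Set (E n → ℝ) :=
  {K | Measurable K ∧ ∀ z : E n, z ≠ 0 →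
    lam / ‖z‖ ^ ((n : ℝ) + 2 * s) ≤ K z ∧ K z ≤ Lam / ‖z‖ ^ ((n : ℝ) + 2 * s)}

/-- Membership in the weighted space `L¹(ω_s)`, `ω_s z = (1 + |z|)^{-(n+2s)}`. -/
def MemL1Weighted {n : ℕ} (s : ℝ) (u : E n → ℝ) : Prop :=
  Integrable (fun z : E n => u z * (1 + ‖z‖) ^ (-((n : ℝ) + 2 * s)))

/-- Pointwise `C^{1,1}` regularity at `x`: near `x`, the function `u` agrees with an affine
function up to a quadratic error. -/
def IsC11At {n : ℕ} (u : E n → ℝ) (x : E n) : Prop :=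
  ∃ (p : E n) (C r : ℝ), 0 < r ∧
    ∀ z : E n, ‖z‖ < r → |u (x + z) - u x - inner ℝ p z| ≤ C * ‖z‖ ^ 2

open Classical in
/-- The linear operator
`L_K u x = ∫ (u (x + z) - u x - 1_{2s ∈ [1,2)} 1_B(z) ∇u(x) · z) K z dz`,
with `B` the open unit ball centred at `0`. -/
def linOp {n : ℕ} (s : ℝ) (K u : E n → ℝ) (x : E n) : ℝ :=
  ∫ z : E n, (u (x + z) - u x
    - (if 2 * s ∈ Set.Ico (1 : ℝ) 2 ∧ z ∈ Metric.ball (0 : E n) 1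
        then inner ℝ (gradient u x) z else 0)) * K z

/-- `I` is a translation invariant, positively `1`-homogeneous nonlocal operator that is elliptic
with respect to `𝒦_s(λ, Λ)`. Its value `I u x` is only meaningful, and only constrained, for
`u ∈ C^{1,1}(x) ∩ L¹(ω_s)`. -/
structure IsEllipticOperator {n : ℕ} (s lam Lam : ℝ) (I : (E n → ℝ) → E n → ℝ) : Prop where
  translation_invariant : ∀ (u : E n → ℝ) (x h : E n),
    MemL1Weighted s u → IsC11At u (x + h) → I (fun y => u (y + h)) x = I u (x + h)
  pos_homogeneous : ∀ (u : E n → ℝ) (x : E n) (t : ℝ), 0 < t →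
    MemL1Weighted s u → IsC11At u x → I (fun y => t * u y) x = t * I u x
  elliptic : ∀ (u v : E n → ℝ) (x : E n),
    MemL1Weighted s u → IsC11At u x → MemL1Weighted s v → IsC11At v x →
      (⨅ K : kernelClass n s lam Lam, (linOp s K.1 u x - linOp s K.1 v x)) ≤ I u x - I v x ∧
      I u x - I v x ≤ ⨆ K : kernelClass n s lam Lam, (linOp s K.1 u x - linOp s K.1 v x)

open Classical in
/-- The function equal to `φ` in the ball `B_r(x₀)` and to `u` elsewhere. -/
def glue {n : ℕ} (u φ : E n → ℝ) (x₀ : E n) (r : ℝ) : E n → ℝ :=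
  fun y => if y ∈ Metric.ball x₀ r then φ y else u y

/-- Viscosity subsolution of `-I u + H(x, u, ∇u) = 0` in `Ω`, for `u : ℝⁿ → U`. Only test functions
for which the glued function lies in `L¹(ω_s)` are used, so that `I` may be evaluated there. -/
structure IsViscositySubsolution {n : ℕ} (s : ℝ) (I : (E n → ℝ) → E n → ℝ)
    (H : E n → ℝ → E n → ℝ) (Ω : Set (E n)) (U : Set ℝ) (u : E n → ℝ) : Prop where
  mem_range : ∀ x, u x ∈ U
  measurable : Measurable u
  memL1 : MemL1Weighted s u
  usc : UpperSemicontinuousOn u (closure Ω)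
  test : ∀ x₀ ∈ Ω, ∀ (r : ℝ) (φ : E n → ℝ), 0 < r →
    ContDiffOn ℝ 2 φ (Metric.ball x₀ r) → u x₀ = φ x₀ →
    (∀ y ∈ Metric.ball x₀ r, u y ≤ φ y) → MemL1Weighted s (glue u φ x₀ r) →
      -I (glue u φ x₀ r) x₀ + H x₀ (u x₀) (gradient φ x₀) ≤ 0

/-- Viscosity supersolution of `-I u + H(x, u, ∇u) = 0` in `Ω`, for `u : ℝⁿ → U`. -/
structure IsViscositySupersolution {n : ℕ} (s : ℝ) (I : (E n → ℝ) → E n → ℝ)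
    (H : E n → ℝ → E n → ℝ) (Ω : Set (E n)) (U : Set ℝ) (u : E n → ℝ) : Prop where
  mem_range : ∀ x, u x ∈ U
  measurable : Measurable u
  memL1 : MemL1Weighted s u
  lsc : LowerSemicontinuousOn u (closure Ω)
  test : ∀ x₀ ∈ Ω, ∀ (r : ℝ) (φ : E n → ℝ), 0 < r →
    ContDiffOn ℝ 2 φ (Metric.ball x₀ r) → u x₀ = φ x₀ →
    (∀ y ∈ Metric.ball x₀ r, φ y ≤ u y) → MemL1Weighted s (glue u φ x₀ r) →
      0 ≤ -I (glue u φ x₀ r) x₀ + H x₀ (u x₀) (gradient φ x₀)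

/-- Viscosity solution of `-I u + H(x, u, ∇u) = 0` in `Ω`, for `u : ℝⁿ → U`. -/
def IsViscositySolution {n : ℕ} (s : ℝ) (I : (E n → ℝ) → E n → ℝ)
    (H : E n → ℝ → E n → ℝ) (Ω : Set (E n)) (U : Set ℝ) (u : E n → ℝ) : Prop :=
  IsViscositySubsolution s I H Ω U u ∧ IsViscositySupersolution s I H Ω U u

end NonlocalLiouville

end

/-! If `u` takes two different values, doubling of variables at a large scale `R`, with coupling `(M
/ R²)|x - y|²`, gives points with `u x - u y ≥ δ` and `|x - y| ≤ R`, where `δ > 0` is independent of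
`R` (`exists_doubling_max`). There `u` is touched from above at `x` and from below at `y` by
paraboloids with slopes of order `R⁻¹` and curvatures of order `R⁻²`. So the gradient term at `x` is
`O(R^{-m})`, and the one at `y` has the favourable sign.

Ellipticity bounds the difference of the two values of the operator by an error `O(R⁻²)` minus a
nonlocal gain. The gain comes from boundedness: increments of `u` along successive translates by `x
- y` telescope, so on some ball of radius `R`, at distance comparable to `R`, the average of `u (x +
z) - u (y + z)` is at most `δ / 2` (`exists_ball_integral_increment_le`). Since the kernel is at
least of order `R^{-n-2s}` there, this contributes at least `c R^{-2s}` (`linOp_jet_sub_le`). Hence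
`c R^{-2s} ≤ C R⁻² + D R^{-m}`, which fails for large `R` because `s < 1` and `m > 2s`. -/

namespace NonlocalLiouville

open Metric Filter Topology

/-! ### Integrability of the Lévy weight and of bounded functions -/

/-- The weight `min 1 |z|² / |z|^{n+2s}`. -/
noncomputable def levyWeight (n : ℕ) (s : ℝ) (z : E n) : ℝ :=
  min 1 (‖z‖ ^ 2) / ‖z‖ ^ ((n : ℝ) + 2 * s)

theorem levyWeight_nonneg (n : ℕ) (s : ℝ) (z : E n) : 0 ≤ levyWeight n s z := by
  unfold levyWeight; positivity

/-- In polar coordinates the radial density is `r^{1-2s}` on `(0, 1]`, integrable as `s < 1`, and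
`r^{-1-2s}` beyond, integrable as `s > 0`. -/
theorem integrable_levyWeight {n : ℕ} {s : ℝ} [Nontrivial (E n)] (hs : 0 < s) (hs1 : s < 1) :
    Integrable (levyWeight n s) := by
  have hfin : Module.finrank ℝ (E n) = n := finrank_euclideanSpace_fin
  have hn : 1 ≤ n := by
    have := Module.finrank_pos (R := ℝ) (M := E n); omega
  have hpow : ∀ y : ℝ, 0 < y → y ^ (n - 1) = y ^ ((n : ℝ) - 1) := fun y hy => by
    rw [← Real.rpow_natCast, Nat.cast_sub hn, Nat.cast_one]
  have key : IntegrableOn (fun y : ℝ => y ^ (Module.finrank ℝ (E n) - 1) •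
      (min 1 (y ^ 2) / y ^ ((n : ℝ) + 2 * s))) (Set.Ioi 0) := by
    rw [hfin, ← Set.Ioc_union_Ioi_eq_Ioi zero_le_one]
    refine IntegrableOn.union ?_ ?_
    · have h := (intervalIntegral.intervalIntegrable_rpow' (a := 0) (b := 1)
        (r := 1 - 2 * s) (by linarith)).1
      refine h.congr_fun (fun y hy => ?_) measurableSet_Ioc
      have hy0 : 0 < y := hy.1
      simp only [smul_eq_mul]
      rw [min_eq_right (pow_le_one₀ hy0.le hy.2), hpow y hy0, ← Real.rpow_natCast y 2,
        ← Real.rpow_sub hy0, ← Real.rpow_add hy0]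
      congr 1; push_cast; ring
    · have h := integrableOn_Ioi_rpow_of_lt (a := -1 - 2 * s) (by linarith) one_pos
      refine h.congr_fun (fun y hy => ?_) measurableSet_Ioi
      have hy1 : 1 < y := hy
      have hy0 : 0 < y := by linarith
      simp only [smul_eq_mul]
      rw [min_eq_left (one_le_pow₀ hy1.le), hpow y hy0, one_div, ← Real.rpow_neg hy0.le,
        ← Real.rpow_add hy0]
      congr 1; ring
  exact (integrable_fun_norm_addHaar (volume : Measure (E n))
    (f := fun y => min 1 (y ^ 2) / y ^ ((n : ℝ) + 2 * s))).2 key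

theorem MemL1Weighted.of_bounded {n : ℕ} {s C : ℝ} {u : E n → ℝ} (hs : 0 < s)
    (hu : Measurable u) (hC : ∀ x, |u x| ≤ C) : MemL1Weighted s u := by
  refine Integrable.bdd_mul (c := C) ?_ hu.aestronglyMeasurable (.of_forall hC)
  exact integrable_one_add_norm (by rw [finrank_euclideanSpace_fin]; linarith)

/-! ### Glued paraboloids as test functions -/

/-- The affine-quadratic polynomial at `x₀` with value `c`, slope `p` and curvature `b`. -/
noncomputable def paraboloid {n : ℕ} (c : ℝ) (x₀ p : E n) (b : ℝ) (y : E n) : ℝ :=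
  c + inner ℝ p (y - x₀) + b * ‖y - x₀‖ ^ 2

theorem contDiff_paraboloid {n : ℕ} (c : ℝ) (x₀ p : E n) (b : ℝ) :
    ContDiff ℝ 2 (paraboloid c x₀ p b) := by
  unfold paraboloid
  have h : ContDiff ℝ 2 (fun y : E n => y - x₀) := contDiff_id.sub contDiff_const
  exact (contDiff_const.add (contDiff_const.inner ℝ h)).add (contDiff_const.mul (h.norm_sq ℝ))

theorem hasGradientAt_paraboloid {n : ℕ} (c : ℝ) (x₀ p : E n) (b : ℝ) :
    HasGradientAt (paraboloid c x₀ p b) p x₀ := by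
  rw [hasGradientAt_iff_hasFDerivAt]
  unfold paraboloid
  have h : HasFDerivAt (fun y : E n => y - x₀) (ContinuousLinearMap.id ℝ (E n)) x₀ :=
    (hasFDerivAt_id x₀).sub_const x₀
  have h1 := (((hasFDerivAt_const p x₀).inner ℝ h).const_add c).add ((h.norm_sq).const_mul b)
  refine h1.congr_fderiv ?_
  ext v
  simp

/-- The translate to the origin of the paraboloid at `x₀` touching `u`, glued to `u` outside the
unit ball. -/
noncomputable def jet {n : ℕ} (u : E n → ℝ) (x₀ p : E n) (b : ℝ) (y : E n) : ℝ :=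
  glue u (paraboloid (u x₀) x₀ p b) x₀ 1 (y + x₀)

section jet

variable {n : ℕ} {u : E n → ℝ} {x₀ p : E n} {b M : ℝ}

theorem jet_of_norm_lt_one {z : E n} (hz : ‖z‖ < 1) :
    jet u x₀ p b z = u x₀ + inner ℝ p z + b * ‖z‖ ^ 2 := by
  simp [jet, glue, paraboloid, hz]

theorem jet_of_one_le_norm {z : E n} (hz : 1 ≤ ‖z‖) : jet u x₀ p b z = u (x₀ + z) := by
  simp [jet, glue, not_lt.2 hz, add_comm]

theorem jet_zero : jet u x₀ p b 0 = u x₀ := by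
  rw [jet_of_norm_lt_one (by simp)]; simp

theorem measurable_glue_paraboloid (hu : Measurable u) :
    Measurable (glue u (paraboloid (u x₀) x₀ p b) x₀ 1) :=
  Measurable.ite measurableSet_ball (contDiff_paraboloid _ _ _ _).continuous.measurable hu

theorem abs_glue_paraboloid_le (hM : ∀ x, |u x| ≤ M) (y : E n) :
    |glue u (paraboloid (u x₀) x₀ p b) x₀ 1 y| ≤ M + ‖p‖ + |b| := by
  unfold glue
  split_ifs with h
  · rw [mem_ball, dist_eq_norm] at h
    unfold paraboloid
    have h1 := hM x₀
    have h2 : |inner ℝ p (y - x₀)| ≤ ‖p‖ :=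
      (abs_real_inner_le_norm _ _).trans (mul_le_of_le_one_right (norm_nonneg _) h.le)
    have h3 : |b * ‖y - x₀‖ ^ 2| ≤ |b| := by
      rw [abs_mul, abs_of_nonneg (sq_nonneg ‖y - x₀‖)]
      exact mul_le_of_le_one_right (abs_nonneg _) (pow_le_one₀ (norm_nonneg _) h.le)
    exact (abs_add_three _ _ _).trans (by linarith)
  · have := hM y
    have := norm_nonneg p
    have := abs_nonneg b
    linarith

theorem measurable_jet (hu : Measurable u) : Measurable (jet u x₀ p b) :=
  (measurable_glue_paraboloid hu).comp (measurable_id.add_const x₀)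

theorem memL1Weighted_glue_paraboloid {s : ℝ} (hs : 0 < s) (hu : Measurable u)
    (hM : ∀ x, |u x| ≤ M) :
    MemL1Weighted s (glue u (paraboloid (u x₀) x₀ p b) x₀ 1) :=
  .of_bounded hs (measurable_glue_paraboloid hu) (abs_glue_paraboloid_le hM)

theorem memL1Weighted_jet {s : ℝ} (hs : 0 < s) (hu : Measurable u) (hM : ∀ x, |u x| ≤ M) :
    MemL1Weighted s (jet u x₀ p b) :=
  .of_bounded hs (measurable_jet hu) fun _ => abs_glue_paraboloid_le hM _

theorem isC11At_glue_paraboloid :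
    IsC11At (glue u (paraboloid (u x₀) x₀ p b) x₀ 1) x₀ := by
  refine ⟨p, |b|, 1, one_pos, fun z hz => ?_⟩
  have h : glue u (paraboloid (u x₀) x₀ p b) x₀ 1 (x₀ + z) -
      glue u (paraboloid (u x₀) x₀ p b) x₀ 1 x₀ - inner ℝ p z = b * ‖z‖ ^ 2 := by
    simp [glue, paraboloid, hz]
    ring
  rw [h, abs_mul, abs_of_nonneg (sq_nonneg ‖z‖)]

theorem isC11At_jet : IsC11At (jet u x₀ p b) 0 := by
  refine ⟨p, |b|, 1, one_pos, fun z hz => ?_⟩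
  have h : jet u x₀ p b (0 + z) - jet u x₀ p b 0 - inner ℝ p z = b * ‖z‖ ^ 2 := by
    rw [zero_add, jet_zero, jet_of_norm_lt_one hz]
    ring
  rw [h, abs_mul, abs_of_nonneg (sq_nonneg ‖z‖)]

theorem gradient_jet : gradient (jet u x₀ p b) 0 = p := by
  have h : jet u x₀ p b =ᶠ[𝓝 0] paraboloid (u x₀) 0 p b := by
    filter_upwards [ball_mem_nhds (0 : E n) one_pos] with z hz
    rw [jet_of_norm_lt_one (by simpa using hz)]
    simp [paraboloid]
  rw [h.gradient_eq, (hasGradientAt_paraboloid _ _ _ _).gradient]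

end jet

/-! ### Viscosity inequalities for jets -/

section viscosity

variable {n : ℕ} {s lam Lam : ℝ} {I : (E n → ℝ) → E n → ℝ} {q m M : ℝ} {Ω : Set (E n)} {U : Set ℝ}
  {u : E n → ℝ} {x₀ p : E n} {b : ℝ}

/-- Ellipticity compares two functions at one point only; moving jets based at different points to
the origin makes it applicable to them. -/
theorem IsEllipticOperator.apply_jet (hI : IsEllipticOperator s lam Lam I) (hs : 0 < s)
    (hu : Measurable u) (hM : ∀ x, |u x| ≤ M) :
    I (jet u x₀ p b) 0 = I (glue u (paraboloid (u x₀) x₀ p b) x₀ 1) x₀ := by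
  have := hI.translation_invariant (glue u (paraboloid (u x₀) x₀ p b) x₀ 1) 0 x₀
    (memL1Weighted_glue_paraboloid hs hu hM) (by rw [zero_add]; exact isC11At_glue_paraboloid)
  rwa [zero_add] at this

theorem IsViscositySubsolution.neg_le_apply_jet (hI : IsEllipticOperator s lam Lam I) (hs : 0 < s)
    (hu : IsViscositySubsolution s I (fun _ r p => -(r ^ q * ‖p‖ ^ m)) Ω U u)
    (hM : ∀ x, |u x| ≤ M) (hx : x₀ ∈ Ω)
    (htouch : ∀ z, u (x₀ + z) ≤ u x₀ + inner ℝ p z + b * ‖z‖ ^ 2) :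
    -(u x₀ ^ q * ‖p‖ ^ m) ≤ I (jet u x₀ p b) 0 := by
  have := hu.test x₀ hx 1 (paraboloid (u x₀) x₀ p b) one_pos
    (contDiff_paraboloid _ _ _ _).contDiffOn (by simp [paraboloid])
    (fun y _ => by simpa [paraboloid] using htouch (y - x₀))
    (memL1Weighted_glue_paraboloid hs hu.measurable hM)
  rw [(hasGradientAt_paraboloid _ _ _ _).gradient, ← hI.apply_jet hs hu.measurable hM] at this
  linarith

theorem IsViscositySupersolution.apply_jet_le (hI : IsEllipticOperator s lam Lam I) (hs : 0 < s)
    (hu : IsViscositySupersolution s I (fun _ r p => -(r ^ q * ‖p‖ ^ m)) Ω U u)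
    (hM : ∀ x, |u x| ≤ M) (hx : x₀ ∈ Ω)
    (htouch : ∀ z, u x₀ + inner ℝ p z + b * ‖z‖ ^ 2 ≤ u (x₀ + z)) :
    I (jet u x₀ p b) 0 ≤ -(u x₀ ^ q * ‖p‖ ^ m) := by
  have := hu.test x₀ hx 1 (paraboloid (u x₀) x₀ p b) one_pos
    (contDiff_paraboloid _ _ _ _).contDiffOn (by simp [paraboloid])
    (fun y _ => by simpa [paraboloid] using htouch (y - x₀))
    (memL1Weighted_glue_paraboloid hs hu.measurable hM)
  rw [(hasGradientAt_paraboloid _ _ _ _).gradient, ← hI.apply_jet hs hu.measurable hM] at this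
  linarith

end viscosity

/-! ### Linear operators on jets -/

section linOp

variable {n : ℕ} {s lam Lam M : ℝ} {K u : E n → ℝ} {x y p p' : E n} {b b' : ℝ}

theorem kernel_nonneg (hlam : 0 < lam) (hK : K ∈ kernelClass n s lam Lam) {z : E n} (hz : z ≠ 0) :
    0 ≤ K z :=
  le_trans (by positivity) (hK.2 z hz).1

theorem min_mul_kernel_le (hK : K ∈ kernelClass n s lam Lam) {z : E n} (hz : z ≠ 0) :
    min 1 (‖z‖ ^ 2) * K z ≤ Lam * levyWeight n s z := by
  refine (mul_le_mul_of_nonneg_left (hK.2 z hz).2 (by positivity)).trans_eq ?_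
  unfold levyWeight; ring

/-- The integrand of `linOp` at the origin for `jet u x p b`, without the kernel. -/
noncomputable def jetIncrement (u : E n → ℝ) (x : E n) (b : ℝ) (z : E n) : ℝ :=
  if ‖z‖ < 1 then b * ‖z‖ ^ 2 else u (x + z) - u x

theorem measurable_jetIncrement (hu : Measurable u) : Measurable (jetIncrement u x b) := by
  refine Measurable.ite (measurableSet_lt measurable_norm measurable_const) (by fun_prop) ?_
  exact (hu.comp (measurable_const_add x)).sub_const _

theorem abs_jetIncrement_le (hM : ∀ x, |u x| ≤ M) (z : E n) :
    |jetIncrement u x b z| ≤ (|b| + 2 * M) * min 1 (‖z‖ ^ 2) := by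
  have hM0 : 0 ≤ M := (abs_nonneg _).trans (hM 0)
  unfold jetIncrement
  split_ifs with h
  · rw [min_eq_right (pow_le_one₀ (norm_nonneg z) h.le), abs_mul, abs_of_nonneg (sq_nonneg ‖z‖)]
    exact mul_le_mul_of_nonneg_right (by linarith) (sq_nonneg _)
  · rw [min_eq_left (one_le_pow₀ (not_lt.1 h)), mul_one]
    have := abs_sub (u (x + z)) (u x)
    have := hM x
    have := hM (x + z)
    have := abs_nonneg b
    linarith

/-- For `s > 1/2` the compensator acts exactly on the unit ball, where the jet is a paraboloid, so
the slope cancels and leaves only the curvature. -/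
theorem linOp_jet (hs : 1 / 2 < s) (hs1 : s < 1) :
    linOp s K (jet u x p b) 0 = ∫ z, jetIncrement u x b z * K z := by
  unfold linOp
  congr 1
  ext z
  congr 1
  rw [gradient_jet, zero_add, jet_zero]
  unfold jetIncrement
  have h2 : 2 * s ∈ Set.Ico (1 : ℝ) 2 := ⟨by linarith, by linarith⟩
  by_cases hz : ‖z‖ < 1
  · simp only [h2, mem_ball_zero_iff, hz, and_self, if_true]
    rw [jet_of_norm_lt_one hz]
    ring
  · simp only [mem_ball_zero_iff, hz, and_false, if_false, sub_zero]
    rw [jet_of_one_le_norm (not_lt.1 hz)]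

theorem integrable_jetIncrement_mul [Nontrivial (E n)] (hs : 0 < s) (hs1 : s < 1) (hlam : 0 < lam)
    (hu : Measurable u) (hM : ∀ x, |u x| ≤ M) (hK : K ∈ kernelClass n s lam Lam) :
    Integrable (fun z => jetIncrement u x b z * K z) := by
  have hM0 : 0 ≤ M := (abs_nonneg _).trans (hM 0)
  refine Integrable.mono' ((integrable_levyWeight hs hs1).const_mul ((|b| + 2 * M) * Lam))
    ((measurable_jetIncrement hu).mul hK.1).aestronglyMeasurable ?_
  have h0 : ∀ᵐ z : E n, z ≠ 0 := by simp [ae_iff]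
  filter_upwards [h0] with z hz
  rw [Real.norm_eq_abs, abs_mul, abs_of_nonneg (kernel_nonneg hlam hK hz), mul_assoc]
  refine (mul_le_mul_of_nonneg_right (abs_jetIncrement_le hM z)
    (kernel_nonneg hlam hK hz)).trans ?_
  rw [mul_assoc]
  exact mul_le_mul_of_nonneg_left (min_mul_kernel_le hK hz) (by positivity)

/-- An upper bound for the difference of `linOp` at two touching jets, when the increment of
`z ↦ u (x + z) - u (y + z)` is at most `κ` and its average over a ball away from the origin is
small. -/
theorem linOp_jet_sub_le [Nontrivial (E n)] (hs : 1 / 2 < s) (hs1 : s < 1) (hlam : 0 < lam)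
    (hLam : lam ≤ Lam) (hu : Measurable u) (hM : ∀ x, |u x| ≤ M)
    (hK : K ∈ kernelClass n s lam Lam) {κ θ ρ R : ℝ} {c : E n} (hκ : 0 ≤ κ) (hb : 0 ≤ b - b')
    (hmax : ∀ z, u (x + z) - u (y + z) ≤ u x - u y + κ) (hfar : ∀ z ∈ ball c R, 1 ≤ ‖z‖)
    (hρ : ∀ z ∈ ball c R, ‖z‖ ≤ ρ)
    (havg : ∫ z in ball c R, (u (x + z) - u (y + z)) ≤
      (u x - u y - θ) * volume.real (ball c R)) :
    linOp s K (jet u x p b) 0 - linOp s K (jet u y p' b') 0 ≤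
      (b - b' + κ) * Lam * (∫ z, levyWeight n s z)
        - θ * (lam / ρ ^ ((n : ℝ) + 2 * s)) * volume.real (ball c R) := by
  have hs0 : 0 < s := by linarith
  have hL0 : 0 ≤ Lam := hlam.le.trans hLam
  rw [linOp_jet hs hs1, linOp_jet hs hs1,
    ← integral_sub (integrable_jetIncrement_mul hs0 hs1 hlam hu hM hK)
      (integrable_jetIncrement_mul hs0 hs1 hlam hu hM hK)]
  set k : ℝ := lam / ρ ^ ((n : ℝ) + 2 * s) with hk
  -- Subtracting `κ` makes `F` nonpositive everywhere, so `K` may be replaced by its lower bound `k`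
  -- on the ball and `F * K` dropped elsewhere outside the unit ball.
  set F : E n → ℝ := fun z => (u (x + z) - u (y + z) - (u x - u y) - κ) with hF
  have hWint : IntegrableOn (fun z => u (x + z) - u (y + z)) (ball c R) := by
    refine Measure.integrableOn_of_bounded (M := M + M) measure_ball_lt_top.ne ?_
      (.of_forall fun z => ?_)
    · exact ((hu.comp (measurable_const_add x)).sub
        (hu.comp (measurable_const_add y))).aestronglyMeasurable
    · exact (norm_sub_le _ _).trans (add_le_add (hM _) (hM _))
  have hcint : ∀ a : ℝ, IntegrableOn (fun _ : E n => a) (ball c R) := fun a =>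
    integrableOn_const measure_ball_lt_top.ne
  have hWint' : IntegrableOn (fun z => u (x + z) - u (y + z) - (u x - u y)) (ball c R) :=
    hWint.sub (hcint _)
  have hFint : IntegrableOn F (ball c R) := hWint'.sub (hcint _)
  have hFval : ∫ z in ball c R, F z ≤ -θ * volume.real (ball c R) := by
    simp only [hF]
    rw [integral_sub hWint' (hcint _), integral_sub hWint (hcint _)]
    simp only [setIntegral_const, smul_eq_mul]
    have : 0 ≤ volume.real (ball c R) * κ := by positivity
    linarith
  have hFind : Integrable ((ball c R).indicator fun z => F z * k) :=
    IntegrableOn.integrable_indicator (hFint.mul_const k) measurableSet_ball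
  have hlev : Integrable fun z => (b - b' + κ) * Lam * levyWeight n s z :=
    (integrable_levyWeight hs0 hs1).const_mul _
  have h0 : ∀ᵐ z : E n, z ≠ 0 := by simp [ae_iff]
  calc ∫ z, (jetIncrement u x b z * K z - jetIncrement u y b' z * K z)
      ≤ ∫ z, ((b - b' + κ) * Lam * levyWeight n s z + (ball c R).indicator (fun z => F z * k) z) := by
        refine integral_mono_ae ((integrable_jetIncrement_mul hs0 hs1 hlam hu hM hK).sub
          (integrable_jetIncrement_mul hs0 hs1 hlam hu hM hK)) (hlev.add hFind) ?_
        filter_upwards [h0] with z hz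
        have hKz := kernel_nonneg hlam hK hz
        have hw := min_mul_kernel_le hK hz
        have hw0 := levyWeight_nonneg n s z
        simp only [← sub_mul]
        by_cases h1 : ‖z‖ < 1
        · have hzB : z ∉ ball c R := fun h => (hfar z h).not_gt h1
          rw [Set.indicator_of_notMem hzB, add_zero]
          rw [min_eq_right (pow_le_one₀ (norm_nonneg z) h1.le)] at hw
          simp only [jetIncrement, h1, if_true]
          have e1 := mul_le_mul_of_nonneg_left hw hb
          have e2 : 0 ≤ κ * (Lam * levyWeight n s z) := by positivity
          linarith
        · have hz1 := not_lt.1 h1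
          rw [min_eq_left (one_le_pow₀ hz1), one_mul] at hw
          simp only [jetIncrement, h1, if_false]
          have e1 := mul_le_mul_of_nonneg_left hw hκ
          have e2 : 0 ≤ (b - b') * (Lam * levyWeight n s z) := by positivity
          have e3 : F z ≤ 0 := by have := hmax z; simp only [hF]; linarith
          have e4 : (u (x + z) - u x - (u (y + z) - u y)) * K z = F z * K z + κ * K z := by
            simp only [hF]; ring
          rw [e4]
          by_cases hzB : z ∈ ball c R
          · rw [Set.indicator_of_mem hzB]
            have e5 : k ≤ K z := by
              refine le_trans ?_ (hK.2 z hz).1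
              have hz0 : 0 < ‖z‖ := norm_pos_iff.2 hz
              exact div_le_div_of_nonneg_left hlam.le (by positivity)
                (Real.rpow_le_rpow hz0.le (hρ z hzB) (by positivity))
            have e6 := mul_le_mul_of_nonpos_left e5 e3
            linarith
          · rw [Set.indicator_of_notMem hzB]
            have e6 := mul_nonneg (neg_nonneg.2 e3) hKz
            linarith
    _ = (b - b' + κ) * Lam * (∫ z, levyWeight n s z) + (∫ z in ball c R, F z) * k := by
        rw [integral_add hlev hFind, integral_const_mul, integral_indicator measurableSet_ball,
          integral_mul_const]
    _ ≤ _ := by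
        -- The sign of `ρ` is not assumed; a negative `ρ` forces the ball to be empty.
        rcases le_or_gt 0 ρ with hρ0 | hρ0
        · have hk0 : 0 ≤ k := by positivity
          have := mul_le_mul_of_nonneg_right hFval hk0
          linarith
        · have hB : ball c R = ∅ :=
            Set.eq_empty_of_forall_notMem fun z hz => by
              have := hρ z hz; have := norm_nonneg z; linarith
          simp [hB]

end linOp

/-! ### Averages of increments of bounded functions -/

theorem setIntegral_ball_comp_add_left {n : ℕ} (u : E n → ℝ) (v c : E n) (R : ℝ) :
    ∫ z in ball c R, u (v + z) = ∫ z in ball (v + c) R, u z := by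
  have h := (measurePreserving_add_left (volume : Measure (E n)) v).setIntegral_preimage_emb
    (measurableEmbedding_addLeft v) u (ball (v + c) R)
  rw [← h]
  congr 2
  ext z
  simp

/-- For a bounded function, the average of the increment `u (y + h + z) - u (y + z)` is small on
some ball of radius `R` away from the origin. -/
theorem exists_ball_integral_increment_le {n : ℕ} {u : E n → ℝ} {M : ℝ} (hu : Measurable u)
    (h0 : ∀ x, 0 ≤ u x) (hM : ∀ x, u x ≤ M) (y : E n) {h : E n} (hh : h ≠ 0) {R : ℝ}
    (hR : 0 < R) (hhR : ‖h‖ ≤ R) {N : ℕ} (hN : 0 < N) :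
    ∃ c : E n, (∀ z ∈ ball c R, R ≤ ‖z‖) ∧ (∀ z ∈ ball c R, ‖z‖ ≤ (N + 3) * R) ∧
      ∫ z in ball c R, (u (y + h + z) - u (y + z)) ≤ M / N * volume.real (ball (0 : E n) R) := by
  have hh0 : 0 < ‖h‖ := norm_pos_iff.2 hh
  -- Consecutive centres differ by `h`, so the integrals telescope; the offset of length `2R` keeps
  -- every ball of radius `R` at distance at least `R` from the origin.
  set c : ℕ → E n := fun k => (2 * R / ‖h‖ + k) • h with hc
  have hcn : ∀ k, ‖c k‖ = 2 * R + k * ‖h‖ := fun k => by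
    rw [hc, norm_smul, Real.norm_of_nonneg (by positivity)]
    field_simp
  have hvol : ∀ x : E n, volume.real (ball x R) = volume.real (ball (0 : E n) R) := fun x => by
    simp only [measureReal_def, Measure.addHaar_ball_center]
  have hint : ∀ v x : E n, IntegrableOn (fun z => u (v + z)) (ball x R) := fun v x => by
    refine Measure.integrableOn_of_bounded (M := M) measure_ball_lt_top.ne
      (hu.comp (measurable_const_add v)).aestronglyMeasurable (.of_forall fun z => ?_)
    rw [Real.norm_of_nonneg (h0 _)]
    exact hM _
  set A : ℕ → ℝ := fun k => ∫ z in ball (y + c k) R, u z with hA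
  have hstep : ∀ k, ∫ z in ball (c k) R, (u (y + h + z) - u (y + z)) = A (k + 1) - A k :=
    fun k => by
      rw [integral_sub (hint _ _) (hint _ _), setIntegral_ball_comp_add_left,
        setIntegral_ball_comp_add_left, hA]
      have : y + h + c k = y + c (k + 1) := by
        simp only [hc, Nat.cast_add, Nat.cast_one, add_smul, one_smul]; abel
      simp only [this]
  have hA0 : ∀ k, 0 ≤ A k := fun k => integral_nonneg h0
  have hAM : ∀ k, A k ≤ M * volume.real (ball (0 : E n) R) := fun k => by
    have h1 : A k ≤ ∫ _ in ball (y + c k) R, M := by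
      have h2 := hint 0 (y + c k)
      simp only [zero_add] at h2
      exact integral_mono h2 (integrableOn_const measure_ball_lt_top.ne) hM
    rwa [setIntegral_const, hvol, smul_eq_mul, mul_comm] at h1
  -- The `N` increments sum to `A N - A 0`, at most `M` times the volume, so one of them is at most
  -- the mean.
  obtain ⟨k, hk, hkle⟩ : ∃ k ∈ Finset.range N,
      A (k + 1) - A k ≤ M / N * volume.real (ball (0 : E n) R) := by
    refine Finset.exists_le_of_sum_le (Finset.nonempty_range_iff.2 hN.ne') ?_
    rw [Finset.sum_range_sub, Finset.sum_const, Finset.card_range, nsmul_eq_mul]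
    have hN' : (0 : ℝ) < N := by exact_mod_cast hN
    have h1 : (N : ℝ) * (M / N * volume.real (ball (0 : E n) R)) =
        M * volume.real (ball (0 : E n) R) := by field_simp
    rw [h1]
    linarith [hAM N, hA0 0]
  have hkN : (k : ℝ) ≤ N := by exact_mod_cast (Finset.mem_range.1 hk).le
  have hkh : (k : ℝ) * ‖h‖ ≤ N * R := mul_le_mul hkN hhR hh0.le (Nat.cast_nonneg N)
  refine ⟨c k, fun z hz => ?_, fun z hz => ?_, (hstep k).trans_le hkle⟩
  · rw [mem_ball, dist_eq_norm] at hz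
    have h1 := norm_sub_norm_le (c k) z
    rw [norm_sub_rev, hcn] at h1
    have h2 : 0 ≤ (k : ℝ) * ‖h‖ := by positivity
    linarith
  · rw [mem_ball, dist_eq_norm] at hz
    have h1 := norm_sub_norm_le z (c k)
    rw [hcn] at h1
    linarith

/-! ### Doubling of variables -/

/-- Tangent paraboloid from above to `κ (1 - 1 / (1 + |t|²))`. -/
theorem penalty_sub_le {n : ℕ} {κ : ℝ} (hκ : 0 ≤ κ) (t z : E n) :
    κ * (1 / (1 + ‖t‖ ^ 2) - 1 / (1 + ‖t + z‖ ^ 2)) ≤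
      κ / (1 + ‖t‖ ^ 2) ^ 2 * (2 * inner ℝ t z + ‖z‖ ^ 2) := by
  have hT : 0 < 1 + ‖t‖ ^ 2 := by positivity
  have hT' : 0 < 1 + ‖t + z‖ ^ 2 := by positivity
  have hz : 2 * inner ℝ t z + ‖z‖ ^ 2 = (1 + ‖t + z‖ ^ 2) - (1 + ‖t‖ ^ 2) := by
    rw [norm_add_sq_real]; ring
  rw [hz, div_eq_mul_inv κ, mul_assoc]
  refine mul_le_mul_of_nonneg_left ?_ hκ
  generalize 1 + ‖t‖ ^ 2 = T at *
  generalize 1 + ‖t + z‖ ^ 2 = T' at *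
  -- Concavity of `T ↦ -1 / T`: the gap to its tangent line is an explicit square over a positive
  -- quantity.
  have h : (T ^ 2)⁻¹ * (T' - T) - (1 / T - 1 / T') = (T' - T) ^ 2 / (T ^ 2 * T') := by
    field_simp
  have : 0 ≤ (T' - T) ^ 2 / (T ^ 2 * T') := by positivity
  linarith

/-- Doubling of variables with a quadratic coupling and a bounded localisation. -/
theorem exists_doubling_max {n : ℕ} {u : E n → ℝ} {M a κ δ : ℝ} (hu : Continuous u)
    (h0 : ∀ x, 0 ≤ u x) (hM : ∀ x, u x ≤ M) (ha : 0 < a) (hκ : 0 < κ) (hδ : 0 < δ)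
    {x₀ y₀ : E n} (hxy : δ ≤ u x₀ - u y₀ - a * ‖x₀ - y₀‖ ^ 2) :
    ∃ (x y v : E n) (c : ℝ), 0 ≤ c ∧ c ≤ κ ∧ ‖v‖ ≤ κ ∧ δ ≤ u x - u y ∧ a * ‖x - y‖ ^ 2 ≤ M ∧
      (∀ z, u (x + z) ≤ u x + inner ℝ ((2 * a) • (x - y) + v) z + (a + c) * ‖z‖ ^ 2) ∧
      (∀ z, u y + inner ℝ ((2 * a) • (x - y)) z + (-a) * ‖z‖ ^ 2 ≤ u (y + z)) ∧
      (∀ z, u (x + z) - u (y + z) ≤ u x - u y + κ) := by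
  set Φ : E n × E n → ℝ := fun w => u w.1 - u w.2 - a * ‖w.1 - w.2‖ ^ 2 with hΦ
  have hΦc : Continuous Φ := by fun_prop
  have hbdd : BddAbove (Set.range Φ) := by
    refine ⟨M, ?_⟩
    rintro _ ⟨w, rfl⟩
    have h1 := h0 w.2
    have h2 := hM w.1
    have h3 : 0 ≤ a * ‖w.1 - w.2‖ ^ 2 := by positivity
    simp only [hΦ]
    linarith
  -- Near-maximality within `κ / 2` matches the penalty, which is at least `κ / 2` once the first
  -- variable is at distance at least `1` from `x₁`.
  obtain ⟨w₁, hw₁, hw₁δ⟩ : ∃ w₁, (⨆ w, Φ w) - κ / 2 < Φ w₁ ∧ δ ≤ Φ w₁ := by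
    obtain ⟨w, hw⟩ := exists_lt_of_lt_ciSup (show (⨆ w, Φ w) - κ / 2 < ⨆ w, Φ w by linarith)
    rcases le_total (Φ w) (Φ (x₀, y₀)) with h | h
    · exact ⟨_, hw.trans_le h, hxy⟩
    · exact ⟨_, hw, hxy.trans h⟩
  have hsup : ∀ w, Φ w < Φ w₁ + κ / 2 := fun w => by
    have := le_ciSup hbdd w; linarith
  set x₁ := w₁.1
  set Ψ : E n × E n → ℝ := fun w => Φ w - κ * (1 - 1 / (1 + ‖w.1 - x₁‖ ^ 2)) with hΨ
  have hΨc : Continuous Ψ := by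
    refine hΦc.sub (continuous_const.mul (continuous_const.sub (continuous_const.div ?_ ?_)))
    · fun_prop
    · intro w; positivity
  have hΨ1 : Ψ w₁ = Φ w₁ := by simp [hΨ, x₁]
  have hg : ∀ t : E n, 0 ≤ 1 - 1 / (1 + ‖t‖ ^ 2) := fun t => by
    rw [sub_nonneg, div_le_one (by positivity)]
    linarith [sq_nonneg ‖t‖]
  obtain ⟨w, hw⟩ : ∃ w, ∀ w', Ψ w' ≤ Ψ w := by
    refine hΨc.exists_forall_ge' w₁ ?_
    -- Beyond separation `ρ` the coupling exceeds `M`, so `Φ ≤ 0 < δ`. Penalising the first variable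
    -- alone therefore confines both.
    set ρ := √(M / a) with hρ
    have hD : IsCompact (closedBall x₁ 1 ×ˢ closedBall x₁ (1 + ρ)) :=
      (isCompact_closedBall _ _).prod (isCompact_closedBall _ _)
    filter_upwards [hD.compl_mem_cocompact] with w hwD
    rw [hΨ1]
    simp only [hΨ]
    by_cases h1 : ‖w.1 - x₁‖ ≤ 1
    · have h2 : ρ < ‖w.1 - w.2‖ := by
        by_contra! h2
        refine hwD ⟨by simpa [dist_eq_norm] using h1, ?_⟩
        rw [mem_closedBall, dist_eq_norm]
        calc ‖w.2 - x₁‖ = ‖(w.1 - x₁) - (w.1 - w.2)‖ := by congr 1; abel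
          _ ≤ _ := (norm_sub_le _ _).trans (add_le_add h1 h2)
      have h3 : M < a * ‖w.1 - w.2‖ ^ 2 := by
        have := Real.lt_sq_of_sqrt_lt h2
        rwa [div_lt_iff₀' ha] at this
      have h4 : Φ w ≤ 0 := by
        simp only [hΦ]
        linarith [h0 w.2, hM w.1]
      have h5 := mul_nonneg hκ.le (hg (w.1 - x₁))
      linarith
    · have h2 : (1 : ℝ) / 2 ≤ 1 - 1 / (1 + ‖w.1 - x₁‖ ^ 2) := by
        have h3 : 1 ≤ ‖w.1 - x₁‖ ^ 2 := one_le_pow₀ (not_le.1 h1).le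
        have h4 : 1 / (1 + ‖w.1 - x₁‖ ^ 2) ≤ 1 / 2 :=
          one_div_le_one_div_of_le two_pos (by linarith)
        linarith
      have h3 := mul_le_mul_of_nonneg_left h2 hκ.le
      have h4 := hsup w
      linarith
  obtain ⟨x, y⟩ := w
  have hval : δ ≤ Ψ (x, y) := by rw [← hΨ1] at hw₁δ; exact hw₁δ.trans (hw w₁)
  have hmax : ∀ x' y', u x' - u y' - a * ‖x' - y'‖ ^ 2 - κ * (1 - 1 / (1 + ‖x' - x₁‖ ^ 2)) ≤
      u x - u y - a * ‖x - y‖ ^ 2 - κ * (1 - 1 / (1 + ‖x - x₁‖ ^ 2)) := fun x' y' => hw (x', y')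
  simp only [hΨ, hΦ] at hval
  set t := x - x₁ with ht
  have hT1 : 1 ≤ 1 + ‖t‖ ^ 2 := by linarith [sq_nonneg ‖t‖]
  have hT2 : 1 + ‖t‖ ^ 2 ≤ (1 + ‖t‖ ^ 2) ^ 2 := le_self_pow₀ hT1 two_ne_zero
  have hT0 : 0 < (1 + ‖t‖ ^ 2) ^ 2 := by positivity
  have hgt := mul_nonneg hκ.le (hg t)
  have haxy : 0 ≤ a * ‖x - y‖ ^ 2 := by positivity
  refine ⟨x, y, (2 * (κ / (1 + ‖t‖ ^ 2) ^ 2)) • t, κ / (1 + ‖t‖ ^ 2) ^ 2, by positivity,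
    div_le_self hκ.le (hT1.trans hT2), ?_, by linarith, ?_, fun z => ?_, fun z => ?_, fun z => ?_⟩
  · rw [norm_smul, Real.norm_of_nonneg (by positivity)]
    have h1 : 2 * ‖t‖ ≤ 1 + ‖t‖ ^ 2 := by nlinarith [sq_nonneg (‖t‖ - 1)]
    calc 2 * (κ / (1 + ‖t‖ ^ 2) ^ 2) * ‖t‖ = κ * (2 * ‖t‖) / (1 + ‖t‖ ^ 2) ^ 2 := by ring
      _ ≤ κ := by
        rw [div_le_iff₀ hT0]
        exact mul_le_mul_of_nonneg_left (h1.trans hT2) hκ.le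
  · linarith [h0 y, hM x]
  · have h1 := hmax (x + z) y
    have h2 := penalty_sub_le hκ.le t z
    rw [show x + z - y = (x - y) + z by abel, show x + z - x₁ = t + z by rw [ht]; abel,
      norm_add_sq_real (x - y) z] at h1
    rw [inner_add_left, real_inner_smul_left, real_inner_smul_left]
    linarith
  · have h1 := hmax x (y + z)
    rw [show x - (y + z) = (x - y) - z by abel, norm_sub_sq_real (x - y) z] at h1
    rw [real_inner_smul_left]
    linarith
  -- A common shift leaves the coupling unchanged; only the penalty varies, by at most `κ`.
  · have h1 := hmax (x + z) (y + z)
    rw [add_sub_add_right_eq_sub] at h1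
    have h2 : 0 ≤ κ * (1 / (1 + ‖x + z - x₁‖ ^ 2)) := by positivity
    have h3 := mul_nonneg hκ.le (hg t)
    linarith

/-! ### Ellipticity for jets and the contradiction at large scale -/

/-- Needed to pass a uniform bound to the real supremum, whose value over an empty index is `0` by
default. -/
theorem nonempty_kernelClass {n : ℕ} {s lam Lam : ℝ} (hLam : lam ≤ Lam) :
    Nonempty (kernelClass n s lam Lam) := by
  refine ⟨⟨fun z => lam / ‖z‖ ^ ((n : ℝ) + 2 * s), by fun_prop, fun z _ => ⟨le_rfl, ?_⟩⟩⟩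
  exact div_le_div_of_nonneg_right hLam (by positivity)

theorem IsEllipticOperator.apply_jet_sub_le {n : ℕ} {s lam Lam M B : ℝ}
    {I : (E n → ℝ) → E n → ℝ} (hI : IsEllipticOperator s lam Lam I) (hs : 0 < s)
    (hLam : lam ≤ Lam) {u : E n → ℝ} (hu : Measurable u) (hM : ∀ x, |u x| ≤ M)
    {x y p p' : E n} {b b' : ℝ} (hB : ∀ K ∈ kernelClass n s lam Lam,
      linOp s K (jet u x p b) 0 - linOp s K (jet u y p' b') 0 ≤ B) :
    I (jet u x p b) 0 - I (jet u y p' b') 0 ≤ B := by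
  have := nonempty_kernelClass (n := n) (s := s) hLam
  exact (hI.elliptic _ _ 0 (memL1Weighted_jet hs hu hM) isC11At_jet (memL1Weighted_jet hs hu hM)
    isC11At_jet).2.trans (ciSup_le fun K => hB K.1 K.2)

theorem IsViscositySolution.continuous {n : ℕ} {s : ℝ} {I : (E n → ℝ) → E n → ℝ}
    {H : E n → ℝ → E n → ℝ} {U : Set ℝ} {u : E n → ℝ}
    (hu : IsViscositySolution s I H Set.univ U u) : Continuous u := by
  have h1 := hu.1.usc
  have h2 := hu.2.lsc
  rw [closure_univ] at h1 h2
  rw [← continuousOn_univ, continuousOn_iff_lower_upperSemicontinuousOn]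
  exact ⟨h2, h1⟩

/-- If `c > 0` and `2s < 2`, `2s < m`, then `c R^{-2s} ≤ C R^{-2} + D R^{-m}` fails for large
`R`. -/
theorem eventually_add_lt_mul_rpow {s m c C D : ℝ} (hs1 : s < 1) (hm : 2 * s < m) (hc : 0 < c) :
    ∀ᶠ R : ℝ in atTop, C * R ^ (-2 : ℝ) + D * R ^ (-m) < c * R ^ (-(2 * s)) := by
  have h1 : Tendsto (fun R : ℝ => C * R ^ (-(2 - 2 * s)) + D * R ^ (-(m - 2 * s))) atTop
      (𝓝 (C * 0 + D * 0)) :=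
    ((tendsto_rpow_neg_atTop (by linarith)).const_mul C).add
      ((tendsto_rpow_neg_atTop (by linarith)).const_mul D)
  filter_upwards [h1.eventually_lt_const (show C * 0 + D * 0 < c by simpa using hc),
    eventually_gt_atTop 0] with R hR hR0
  have h2 := mul_lt_mul_of_pos_right hR (Real.rpow_pos_of_pos hR0 (-(2 * s)))
  rw [add_mul, mul_assoc, mul_assoc, ← Real.rpow_add hR0, ← Real.rpow_add hR0,
    show -(2 - 2 * s) + -(2 * s) = -2 by ring, show -(m - 2 * s) + -(2 * s) = -m by ring] at h2
  exact h2

/-- A bounded positive viscosity solution takes no value above another one. -/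
theorem IsViscositySolution.apply_le_apply {n : ℕ} {s lam Lam : ℝ} (hs : 1 / 2 < s) (hs1 : s < 1) (hlam : 0 < lam)
    (hLam : lam ≤ Lam) {I : (E n → ℝ) → E n → ℝ} (hI : IsEllipticOperator s lam Lam I)
    {m q : ℝ} (hm : 2 * s < m) (hq : 0 < q) {u : E n → ℝ} (hpos : ∀ x, 0 < u x) {M : ℝ}
    (hM : ∀ x, u x ≤ M)
    (hu : IsViscositySolution s I (fun _ r p => -(r ^ q * ‖p‖ ^ m)) Set.univ (Set.Ioi 0) u)
    (x₀ y₀ : E n) : u x₀ ≤ u y₀ := by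
  by_contra! hlt
  have hne : x₀ ≠ y₀ := fun h => by simp [h] at hlt
  have : Nontrivial (E n) := ⟨x₀, y₀, hne⟩
  have hs0 : 0 < s := by linarith
  have hM0 : 0 < M := (hpos x₀).trans_le (hM x₀)
  have habs : ∀ x, |u x| ≤ M := fun x => by rw [abs_of_pos (hpos x)]; exact hM x
  have hmeas := hu.1.measurable
  -- Half of the gap is kept; the other half absorbs the coupling at `(x₀, y₀)` for large `R`.
  set δ := (u x₀ - u y₀) / 2 with hδ
  have hδ0 : 0 < δ := by linarith
  -- `N` is fixed before `R`, so the constant in the gain does not depend on `R`. The average `M / N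
  -- ≤ δ / 2` leaves a deficit `θ = δ / 2`.
  obtain ⟨N, hN0, hN⟩ : ∃ N : ℕ, 0 < N ∧ M / N ≤ δ / 2 := by
    obtain ⟨N, hN⟩ := exists_nat_gt (M / (δ / 2))
    have hN0 : (0 : ℝ) < N := lt_trans (by positivity) hN
    refine ⟨N, by exact_mod_cast hN0, ?_⟩
    rw [div_lt_iff₀ (by positivity)] at hN
    rw [div_le_iff₀ hN0]
    linarith
  set J := ∫ z, levyWeight n s z with hJ
  have hJ0 : 0 ≤ J := integral_nonneg (levyWeight_nonneg n s)
  set V := volume.real (ball (0 : E n) 1) with hV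
  have hV0 : 0 < V := ENNReal.toReal_pos (measure_ball_pos _ _ one_pos).ne' measure_ball_lt_top.ne
  have hN3 : (0 : ℝ) < N + 3 := by positivity
  have hsq : Tendsto (fun R : ℝ => M * ‖x₀ - y₀‖ ^ 2 * R ^ (-2 : ℝ)) atTop (nhds 0) := by
    simpa using (tendsto_rpow_neg_atTop two_pos).const_mul (M * ‖x₀ - y₀‖ ^ 2)
  obtain ⟨R, hR, hRδ, hR1⟩ := ((eventually_add_lt_mul_rpow (C := (2 * M + 2) * Lam * J)
    (D := M ^ q * (2 * M + 1) ^ m) hs1 hm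
    (show 0 < δ / 2 * (lam / (N + 3) ^ ((n : ℝ) + 2 * s)) * V by positivity)).and
    ((hsq.eventually_lt_const hδ0).and (eventually_ge_atTop 1))).exists
  have hR0 : 0 < R := by linarith
  have hR2 : R ^ (-2 : ℝ) = 1 / R ^ 2 := by
    rw [Real.rpow_neg hR0.le, Real.rpow_two, one_div]
  rw [hR2] at hRδ hR
  -- With `a = M / R²`, the bound `a * ‖x - y‖ ^ 2 ≤ M` becomes `‖x - y‖ ≤ R`; `κ = 1 / R²` keeps
  -- the penalty errors at the order of the curvature.
  obtain ⟨x, y, v, c, hc0, hcκ, hv, hδxy, hxy, htx, hty, hmax⟩ :=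
    exists_doubling_max (a := M / R ^ 2) (κ := 1 / R ^ 2) hu.continuous (fun x => (hpos x).le) hM
      (by positivity) (by positivity) hδ0 (x₀ := x₀) (y₀ := y₀) (by
        have : M / R ^ 2 * ‖x₀ - y₀‖ ^ 2 = M * ‖x₀ - y₀‖ ^ 2 * (1 / R ^ 2) := by ring
        linarith)
  have hxyR : ‖x - y‖ ≤ R := by
    rw [div_mul_eq_mul_div, div_le_iff₀ (by positivity)] at hxy
    exact (pow_le_pow_iff_left₀ (norm_nonneg _) hR0.le two_ne_zero).1 (le_of_mul_le_mul_left hxy hM0)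
  have hxy0 : x - y ≠ 0 := fun h => by
    rw [sub_eq_zero.1 h] at hδxy; linarith
  obtain ⟨e, hfar, hnear, havg⟩ := exists_ball_integral_increment_le hmeas (fun x => (hpos x).le) hM
    y hxy0 hR0 hxyR hN0
  have hvol : ∀ x : E n, volume.real (ball x R) = R ^ n * V := fun x => by
    rw [measureReal_def, Measure.addHaar_ball _ _ hR0.le, finrank_euclideanSpace_fin,
      ENNReal.toReal_mul, ENNReal.toReal_ofReal (by positivity)]
    rfl
  rw [add_sub_cancel] at havg
  set p := (2 * (M / R ^ 2)) • (x - y) + v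
  have hp : ‖p‖ ≤ (2 * M + 1) * R⁻¹ := by
    have h1 : ‖(2 * (M / R ^ 2)) • (x - y)‖ ≤ 2 * M * R⁻¹ := by
      rw [norm_smul, Real.norm_of_nonneg (by positivity)]
      refine (mul_le_mul_of_nonneg_left hxyR (by positivity)).trans_eq ?_
      field_simp
    have h2 : 1 / R ^ 2 ≤ R⁻¹ := by
      rw [one_div]
      exact inv_anti₀ hR0 (le_self_pow₀ hR1 two_ne_zero)
    exact (norm_add_le _ _).trans (by linarith)
  have hsub := hu.1.neg_le_apply_jet hI hs0 habs (Set.mem_univ x) htx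
  have hsup := hu.2.apply_jet_le hI hs0 habs (Set.mem_univ y) hty
  have hdiff := hI.apply_jet_sub_le hs0 hLam hmeas habs fun K hK =>
    linOp_jet_sub_le (x := x) (y := y) (p := p) (p' := (2 * (M / R ^ 2)) • (x - y))
      (b := M / R ^ 2 + c) (b' := -(M / R ^ 2)) hs hs1 hlam hLam hmeas habs hK
      (κ := 1 / R ^ 2) (θ := δ / 2) (ρ := (N + 3) * R) (by positivity)
      (by have : 0 < M / R ^ 2 := by positivity
          linarith) hmax (fun z hz => hR1.trans (hfar z hz)) hnear (by
        refine havg.trans ?_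
        rw [hvol, hvol]
        exact mul_le_mul_of_nonneg_right (by linarith) (by positivity))
  have hgrad : u x ^ q * ‖p‖ ^ m ≤ M ^ q * (2 * M + 1) ^ m * R ^ (-m) := by
    rw [mul_assoc, Real.rpow_neg hR0.le, ← Real.inv_rpow hR0.le,
      ← Real.mul_rpow (by positivity) (by positivity)]
    exact mul_le_mul (Real.rpow_le_rpow (hpos x).le (hM x) hq.le)
      (Real.rpow_le_rpow (norm_nonneg p) hp (by linarith)) (by positivity) (by positivity)
  have hsup0 : 0 ≤ u y ^ q * ‖(2 * (M / R ^ 2)) • (x - y)‖ ^ m :=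
    mul_nonneg (Real.rpow_nonneg (hpos y).le _) (by positivity)
  have hcoef : (M / R ^ 2 + c - -(M / R ^ 2) + 1 / R ^ 2) * Lam * J ≤
      (2 * M + 2) * Lam * J * (1 / R ^ 2) := by
    have h1 : M / R ^ 2 + c - -(M / R ^ 2) + 1 / R ^ 2 ≤ (2 * M + 2) * (1 / R ^ 2) := by
      have : M / R ^ 2 = M * (1 / R ^ 2) := by ring
      linarith
    have h2 : 0 ≤ Lam * J := mul_nonneg (hlam.le.trans hLam) hJ0
    have := mul_le_mul_of_nonneg_right h1 h2
    linarith
  -- The volume factor `R ^ n` cancels the dimensional part of the kernel bound, leaving `R^{-2s}`.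
  have hgain : δ / 2 * (lam / ((N + 3) * R) ^ ((n : ℝ) + 2 * s)) * volume.real (ball e R) =
      δ / 2 * (lam / (N + 3) ^ ((n : ℝ) + 2 * s)) * V * R ^ (-(2 * s)) := by
    rw [hvol, Real.mul_rpow hN3.le hR0.le, Real.rpow_add hR0, Real.rpow_natCast,
      Real.rpow_neg hR0.le]
    field_simp
  linarith

end NonlocalLiouville

theorem mainTheorem4 (n : ℕ) (s lam Lam : ℝ) (hs : 1 / 2 < s) (hs1 : s < 1)
    (hlam : 0 < lam) (hLam : lam ≤ Lam)
    (I : (NonlocalLiouville.E n → ℝ) → NonlocalLiouville.E n → ℝ)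
    (hI : NonlocalLiouville.IsEllipticOperator s lam Lam I)
    (m q : ℝ) (hm : 2 * s < m) (hq : 0 < q)
    (u : NonlocalLiouville.E n → ℝ) (hpos : ∀ x, 0 < u x) (hbdd : ∃ M : ℝ, ∀ x, u x ≤ M)
    (hu : NonlocalLiouville.IsViscositySolution s I (fun _ r p => -(r ^ q * ‖p‖ ^ m))
      Set.univ (Set.Ioi 0) u) :
    ∃ c : ℝ, ∀ x, u x = c := by
  obtain ⟨M, hM⟩ := hbdd
  exact ⟨u 0, fun x => le_antisymm
    (hu.apply_le_apply hs hs1 hlam hLam hI hm hq hpos hM x 0)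
    (hu.apply_le_apply hs hs1 hlam hLam hI hm hq hpos hM 0 x)⟩
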